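/- Let $n\ge 2$ be an integer and let $\alpha,\beta>0$. For $\gamma>0$ let $d\mu_\gamma(y)=(\pi\gamma)^{-n/2}e^{-|y|^2/\gamma}\,dy$ be the Gaussian probability measure on $\mathbb{R}^n$. For $m\ge 0$, $x\in\mathbb{R}^n$ and a unit vector $\xi$, let $\mathcal{Y}_m(x,\xi)$ be the zonal harmonic of degree $m$ with pole $\xi$, that is, $\mathcal{Y}_0=1$ and, for $m>0$, $$\mathcal{Y}_m(x,\xi)=(n+2m-2)\sum_{k=0}^{\lfloor m/2\rfloor}(-1)^k\,\frac{n(n+2)\cdots(n+2m-2k-4)}{2^k\,k!\,(m-2k)!}\,\langle x,\xi\rangle^{m-2k}|x|^{2k}$$ (the product has $m-k-1$ factors, and an empty product is $1$). For $y\in\mathbb{R}^n\setminus\{0\}$ put $Y_m(x,y)=|y|^m\,\mathcal{Y}_m(x,y/|y|)$, and put $Y_0(x,0)=1$ and $Y_m(x,0)=0$ for $m>0$. The harmonic Fock kernel is $$H_\alpha(x,y)=\sum_{k=0}^\infty\frac{Y_k(x,y)}{\alpha^k\,(n/2)_k},\qquad (a)_k=a(a+1)\cdots(a+k-1),$$ and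 $P_\alpha$ is the integral operator $$P_\alpha f(x)=\int_{\mathbb{R}^n}H_\alpha(x,y)f(y)\,d\mu_\alpha(y)$$ (on $L^2(\mathbb{R}^n,d\mu_\alpha)$ it is the orthogonal projection onto the subspace of harmonic functions), defined for those real- or complex-valued $f$ for which the integral converges absolutely for almost every $x$. For $0<p<\infty$, say that $P_\alpha$ is bounded on $L^p(\mathbb{R}^n,d\mu_\beta)$ if there is a constant $C$ such that $P_\alpha f\in L^p(\mathbb{R}^n,d\mu_\beta)$ and $\|P_\alpha f\|_{L^p(d\mu_\beta)}\le C\|f\|_{L^p(d\mu_\beta)}$ for every $f\in L^p(\mathbb{R}^n,d\mu_\beta)$ for which $P_\alpha f$ is defined. Then: 1. If $1\le p<\infty$ and $P_\alpha$ is bounded on $L^p(\mathbb{R}^n,d\mu_\beta)$, then $p\beta=2\alpha$. 2. If $0<p<1$, then $P_\alpha$ is not bounded on $L^p(\mathbb{R}^n,d\mu_\beta)$. -/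

import Mathlib

open MeasureTheory
open scoped ENNReal NNReal

noncomputable section

namespace HarmonicFock

/-- The probability measure `(π α)^(-n/2) exp (-|y|² / α) dy` on `ℝⁿ`. -/
def gaussian (n : ℕ) (α : ℝ) : Measure (EuclideanSpace ℝ (Fin n)) :=
  volume.withDensity fun y =>
    ENNReal.ofReal ((Real.pi * α) ^ (-(n : ℝ) / 2) * Real.exp (-‖y‖ ^ 2 / α))

/-- The zonal harmonic of degree `m` with pole `ξ` (a unit vector), as a homogeneous harmonic
polynomial in `x ∈ ℝⁿ`: it is `1` for `m = 0`, and for `m > 0` it is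
`(n+2m-2) ∑_{k ≤ m/2} (-1)^k n(n+2)⋯(n+2m-2k-4) / (2^k k! (m-2k)!) ⟨x,ξ⟩^(m-2k) |x|^(2k)`.
The product has `m - k - 1 ≥ 0` factors, so no natural subtraction below truncates when
`m > 0`. -/
def zonal {n : ℕ} (m : ℕ) (x ξ : EuclideanSpace ℝ (Fin n)) : ℝ :=
  if m = 0 then 1
  else ((n : ℝ) + 2 * m - 2) * ∑ k ∈ Finset.range (m / 2 + 1),
    (-1) ^ k * (∏ j ∈ Finset.range (m - k - 1), ((n : ℝ) + 2 * j))
      / (2 ^ k * (k.factorial : ℝ) * ((m - 2 * k).factorial : ℝ))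
      * inner ℝ x ξ ^ (m - 2 * k) * ‖x‖ ^ (2 * k)

/-- The extended zonal harmonic `Y_m(x, y) = |y|^m 𝒴_m(x, y/|y|)`; at `y = 0` it is `1` if `m = 0`
and `0` otherwise. -/
def zonalExt {n : ℕ} (m : ℕ) (x y : EuclideanSpace ℝ (Fin n)) : ℝ :=
  ‖y‖ ^ m * zonal m x (‖y‖⁻¹ • y)

/-- The harmonic Fock kernel `H_α(x, y) = ∑_k Y_k(x, y) / (α^k (n/2)_k)`, where `(a)_k` is the
rising factorial. -/
def kernel {n : ℕ} (α : ℝ) (x y : EuclideanSpace ℝ (Fin n)) : ℝ :=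
  ∑' k : ℕ, zonalExt k x y / (α ^ k * (ascPochhammer ℝ k).eval ((n : ℝ) / 2))

/-- The integral operator `P_α f(x) = ∫ H_α(x, y) f(y) dμ_α(y)`. -/
def proj {n : ℕ} {𝕜 : Type*} [RCLike 𝕜] (α : ℝ) (f : EuclideanSpace ℝ (Fin n) → 𝕜)
    (x : EuclideanSpace ℝ (Fin n)) : 𝕜 :=
  ∫ y, kernel α x y • f y ∂(gaussian n α)

/-- `f` lies in the natural domain of `P_α`: the integral defining `P_α f(x)` converges absolutely
for almost every `x`. -/
def InDomain {n : ℕ} {𝕜 : Type*} [RCLike 𝕜] (α : ℝ) (f : EuclideanSpace ℝ (Fin n) → 𝕜) : Prop :=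
  ∀ᵐ x : EuclideanSpace ℝ (Fin n), Integrable (fun y => kernel α x y • f y) (gaussian n α)

/-- `P_α` is bounded on `L^p(ℝⁿ, dμ_β)` (scalars `𝕜 = ℝ` or `ℂ`): for some constant `C`, every
`f ∈ L^p(dμ_β)` for which `P_α f` is defined has `P_α f ∈ L^p(dμ_β)` and `‖P_α f‖ ≤ C ‖f‖`.
It is not required that `P_α f` be defined for every `f ∈ L^p(dμ_β)`, so that this is implied by
boundedness of `P_α` as an operator defined on the whole space. -/
def BoundedOn (𝕜 : Type*) [RCLike 𝕜] (n : ℕ) (α β p : ℝ) : Prop :=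
  ∃ C : ℝ≥0, ∀ f : EuclideanSpace ℝ (Fin n) → 𝕜,
    MemLp f (ENNReal.ofReal p) (gaussian n β) → InDomain α f →
      MemLp (proj α f) (ENNReal.ofReal p) (gaussian n β) ∧
        eLpNorm (proj α f) (ENNReal.ofReal p) (gaussian n β)
          ≤ C * eLpNorm f (ENNReal.ofReal p) (gaussian n β)

end HarmonicFock

end

noncomputable section

namespace HarmonicFock

variable {n : ℕ}

/-! Write z = y₀ + i y₁. The polynomials Re z^m are harmonic and homogeneous, and multiplying them
by exp(-s|y|²) with s ≠ 0, of either sign, gives functions whose projection and whose norm are both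
explicit. The projection replaces the Gaussian factor by a scalar: P_α(exp(-s|y|²) Re z^m) =
(1+sα)^(-(m+n/2)) Re z^m (`proj_testFun`). Rescaling gives the L^p(dμ_β) norm of the test function
as (1+psβ)^(-(m/2+n/(2p))) times its value at s = 0 (`eLpNorm_testFun`). Boundedness therefore
bounds the first power by a constant multiple of the second, uniformly in m and s
(`BoundedOn.exists_le`). Letting m → ∞ at fixed s gives 1+psβ ≤ (1+sα)². Both sides equal 1 at s = 0
and s may take either sign, so the slopes agree: pβ = 2α. If p < 1, take m = 0 and s → ∞: s^(-n/2)
cannot be O(s^(-n/(2p))). The main work is `integral_kernel_smul`: integrated against exp(-t|y|²)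
z^m, only the degree m term of the kernel survives. Integration by parts gives a recursion for
Gaussian moments, hence closed forms. For degrees k ≠ m the surviving sum, if any, is a finite
difference of order i of a polynomial of degree below i. -/

/-! ### Functions of exponential growth and their Gaussian integrability. -/

/-- Continuous functions of at most exponential growth. -/
def ExpGrowth {G : Type*} [NormedAddCommGroup G] (F : EuclideanSpace ℝ (Fin n) → G) : Prop :=
  Continuous F ∧ ∃ C B : ℝ, ∀ y, ‖F y‖ ≤ C * Real.exp (B * ‖y‖)

theorem ExpGrowth.exists_nonneg {G : Type*} [NormedAddCommGroup G]
    {F : EuclideanSpace ℝ (Fin n) → G} (hF : ExpGrowth F) :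
    ∃ C B : ℝ, 0 ≤ C ∧ 0 ≤ B ∧ ∀ y, ‖F y‖ ≤ C * Real.exp (B * ‖y‖) := by
  obtain ⟨-, C, B, h⟩ := hF
  refine ⟨|C|, |B|, abs_nonneg _, abs_nonneg _, fun y => (h y).trans ?_⟩
  gcongr
  · exact le_abs_self C
  · exact le_abs_self B

theorem integrable_exp_neg_mul_sq_norm {t : ℝ} (ht : 0 < t) :
    Integrable (fun y : EuclideanSpace ℝ (Fin n) => Real.exp (-t * ‖y‖ ^ 2)) := by
  have h := (GaussianFourier.integrable_cexp_neg_mul_sq_norm_add (V := EuclideanSpace ℝ (Fin n))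
    (b := (t : ℂ)) (by simpa using ht) 0 0).norm
  refine h.congr (Filter.Eventually.of_forall fun y => ?_)
  simp only [Complex.norm_exp]
  congr 1
  simp [← Complex.ofReal_pow]

/-- Completing the square: half of the Gaussian decay absorbs the exponential. -/
theorem exp_mul_gaussian_le {t : ℝ} (ht : 0 < t) (B r : ℝ) :
    Real.exp (-t * r ^ 2) * Real.exp (B * r)
      ≤ Real.exp (B ^ 2 / (2 * t)) * Real.exp (-(t / 2) * r ^ 2) := by
  rw [← Real.exp_add, ← Real.exp_add]
  apply Real.exp_le_exp.2
  have : B ^ 2 / (2 * t) + -(t / 2) * r ^ 2 - (-t * r ^ 2 + B * r)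
      = (t * r - B) ^ 2 / (2 * t) := by
    field_simp
    ring
  have h2 : 0 ≤ (t * r - B) ^ 2 / (2 * t) := by positivity
  linarith

theorem ExpGrowth.integrable {G : Type*} [NormedAddCommGroup G] [NormedSpace ℝ G]
    {F : EuclideanSpace ℝ (Fin n) → G} (hF : ExpGrowth F) {t : ℝ} (ht : 0 < t) :
    Integrable (fun y => Real.exp (-t * ‖y‖ ^ 2) • F y) := by
  obtain ⟨C, B, hC, hB, h⟩ := hF.exists_nonneg
  have hc := hF.1
  refine Integrable.mono' (((integrable_exp_neg_mul_sq_norm (n := n) (half_pos ht)).const_mul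
    (C * Real.exp (B ^ 2 / (2 * t))))) (Continuous.aestronglyMeasurable (by fun_prop))
    (Filter.Eventually.of_forall fun y => ?_)
  rw [norm_smul, Real.norm_of_nonneg (Real.exp_pos _).le]
  calc Real.exp (-t * ‖y‖ ^ 2) * ‖F y‖
      ≤ Real.exp (-t * ‖y‖ ^ 2) * (C * Real.exp (B * ‖y‖)) := by gcongr; exact h y
    _ = C * (Real.exp (-t * ‖y‖ ^ 2) * Real.exp (B * ‖y‖)) := by ring
    _ ≤ C * (Real.exp (B ^ 2 / (2 * t)) * Real.exp (-(t / 2) * ‖y‖ ^ 2)) := by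
        exact mul_le_mul_of_nonneg_left (exp_mul_gaussian_le ht B _) hC
    _ = _ := by ring

theorem ExpGrowth.add {G : Type*} [NormedAddCommGroup G]
    {F H : EuclideanSpace ℝ (Fin n) → G} (hF : ExpGrowth F) (hH : ExpGrowth H) :
    ExpGrowth (fun y => F y + H y) := by
  obtain ⟨C, B, hC, hB, h⟩ := hF.exists_nonneg
  obtain ⟨C', B', hC', hB', h'⟩ := hH.exists_nonneg
  refine ⟨hF.1.add hH.1, C + C', B + B', fun y => (norm_add_le _ _).trans ?_⟩
  rw [add_mul]
  refine add_le_add ((h y).trans ?_) ((h' y).trans ?_) <;> gcongr <;> linarith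

theorem ExpGrowth.mul {F H : EuclideanSpace ℝ (Fin n) → ℂ} (hF : ExpGrowth F)
    (hH : ExpGrowth H) : ExpGrowth (fun y => F y * H y) := by
  obtain ⟨C, B, hC, hB, h⟩ := hF.exists_nonneg
  obtain ⟨C', B', hC', hB', h'⟩ := hH.exists_nonneg
  refine ⟨hF.1.mul hH.1, C * C', B + B', fun y => ?_⟩
  rw [norm_mul, add_mul, Real.exp_add]
  calc ‖F y‖ * ‖H y‖ ≤ (C * Real.exp (B * ‖y‖)) * (C' * Real.exp (B' * ‖y‖)) := by
        gcongr
        · exact h y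
        · exact h' y
    _ = _ := by ring

theorem expGrowth_const (c : ℂ) : ExpGrowth (fun _ : EuclideanSpace ℝ (Fin n) => c) :=
  ⟨continuous_const, ‖c‖, 0, fun y => by simp⟩

theorem expGrowth_clm (L : EuclideanSpace ℝ (Fin n) →L[ℝ] ℂ) : ExpGrowth (fun y => L y) := by
  refine ⟨L.continuous, ‖L‖, 1, fun y => (L.le_opNorm y).trans ?_⟩
  gcongr
  linarith [Real.add_one_le_exp (1 * ‖y‖)]

/-- Differentiable functions of at most exponential growth together with their first-order
directional derivatives. -/
structure Tame (F : EuclideanSpace ℝ (Fin n) → ℂ) : Prop where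
  differentiable : Differentiable ℝ F
  growth : ExpGrowth F
  growth_fderiv : ∀ a, ExpGrowth (fun y => fderiv ℝ F y a)

theorem tame_const (c : ℂ) : Tame (fun _ : EuclideanSpace ℝ (Fin n) => c) :=
  ⟨differentiable_const _, expGrowth_const c, fun a => by simpa using expGrowth_const 0⟩

theorem tame_clm (L : EuclideanSpace ℝ (Fin n) →L[ℝ] ℂ) : Tame (fun y => L y) :=
  ⟨L.differentiable, expGrowth_clm L, fun a => by simpa using expGrowth_const (L a)⟩

theorem Tame.mul {F H : EuclideanSpace ℝ (Fin n) → ℂ} (hF : Tame F) (hH : Tame H) :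
    Tame (fun y => F y * H y) := by
  refine ⟨hF.1.mul hH.1, hF.2.mul hH.2, fun a => ?_⟩
  have : (fun y => fderiv ℝ (fun y => F y * H y) y a)
      = fun y => F y * fderiv ℝ H y a + H y * fderiv ℝ F y a := by
    funext y
    rw [fderiv_fun_mul (hF.1 y) (hH.1 y)]
    simp
  rw [this]
  exact (hF.2.mul (hH.3 a)).add (hH.2.mul (hF.3 a))

theorem Tame.pow {F : EuclideanSpace ℝ (Fin n) → ℂ} (hF : Tame F) (k : ℕ) :
    Tame (fun y => F y ^ k) := by
  induction k with
  | zero => simpa using tame_const 1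
  | succ k ih => simpa only [pow_succ] using ih.mul hF

/-- The linear form `y ↦ ⟨x, y⟩`, with complex values. -/
def innerForm (x : EuclideanSpace ℝ (Fin n)) : EuclideanSpace ℝ (Fin n) →L[ℝ] ℂ :=
  Complex.ofRealCLM.comp (innerSL ℝ x)

@[simp] theorem innerForm_apply (x y : EuclideanSpace ℝ (Fin n)) :
    innerForm x y = ((inner ℝ x y : ℝ) : ℂ) := by simp [innerForm]

theorem fderiv_normSq (y a : EuclideanSpace ℝ (Fin n)) :
    fderiv ℝ (fun y : EuclideanSpace ℝ (Fin n) => ((‖y‖ ^ 2 : ℝ) : ℂ)) y a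
      = 2 * innerForm a y := by
  have h := Complex.ofRealCLM.hasFDerivAt.comp y (hasStrictFDerivAt_norm_sq y).hasFDerivAt
  have h' : HasFDerivAt (fun y : EuclideanSpace ℝ (Fin n) => ((‖y‖ ^ 2 : ℝ) : ℂ)) _ y := h
  rw [h'.fderiv]
  simp [real_inner_comm]

theorem tame_normSq : Tame (fun y : EuclideanSpace ℝ (Fin n) => ((‖y‖ ^ 2 : ℝ) : ℂ)) := by
  refine ⟨fun y => ?_, ⟨by fun_prop, 2, 1, fun y => ?_⟩, fun a => ?_⟩
  · exact (Complex.ofRealCLM.hasFDerivAt.comp y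
      (hasStrictFDerivAt_norm_sq y).hasFDerivAt).differentiableAt
  · rw [Complex.norm_real, Real.norm_of_nonneg (by positivity), one_mul]
    have := Real.quadratic_le_exp_of_nonneg (norm_nonneg y)
    nlinarith [norm_nonneg y]
  · simp only [fderiv_normSq]
    exact (expGrowth_const 2).mul (expGrowth_clm (innerForm a))

/-! ### Gaussian integration by parts. -/

/-- The Gaussian integral `∫ exp (-t |y|²) F(y) dy`. -/
def gint (t : ℝ) (F : EuclideanSpace ℝ (Fin n) → ℂ) : ℂ :=
  ∫ y, Real.exp (-t * ‖y‖ ^ 2) • F y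

theorem gint_add {t : ℝ} (ht : 0 < t) {F H : EuclideanSpace ℝ (Fin n) → ℂ}
    (hF : ExpGrowth F) (hH : ExpGrowth H) :
    gint t (fun y => F y + H y) = gint t F + gint t H := by
  simp only [gint, smul_add]
  exact integral_add (hF.integrable ht) (hH.integrable ht)

theorem gint_const_mul (t : ℝ) (c : ℂ) (F : EuclideanSpace ℝ (Fin n) → ℂ) :
    gint t (fun y => c * F y) = c * gint t F := by
  simp only [gint]
  rw [← integral_const_mul]
  exact integral_congr_ae (Filter.Eventually.of_forall fun y => by
    simp only [Complex.real_smul]; ring)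

theorem gint_sum {t : ℝ} (ht : 0 < t) {ι : Type*} (s : Finset ι)
    {F : ι → EuclideanSpace ℝ (Fin n) → ℂ} (hF : ∀ i ∈ s, ExpGrowth (F i)) :
    gint t (fun y => ∑ i ∈ s, F i y) = ∑ i ∈ s, gint t (F i) := by
  simp only [gint, Finset.smul_sum]
  exact integral_finsetSum s fun i hi => (hF i hi).integrable ht

theorem hasFDerivAt_gaussian (t : ℝ) (y : EuclideanSpace ℝ (Fin n)) :
    HasFDerivAt (fun y : EuclideanSpace ℝ (Fin n) => Real.exp (-t * ‖y‖ ^ 2))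
      (Real.exp (-t * ‖y‖ ^ 2) • ((-t) • (2 • innerSL ℝ y))) y :=
  ((hasStrictFDerivAt_norm_sq y).hasFDerivAt.const_mul (-t)).exp

/-- Gaussian integration by parts. -/
theorem gint_innerForm_mul {t : ℝ} (ht : 0 < t) {F : EuclideanSpace ℝ (Fin n) → ℂ} (hF : Tame F)
    (a : EuclideanSpace ℝ (Fin n)) :
    gint t (fun y => innerForm a y * F y) = (2 * t : ℂ)⁻¹ * gint t (fun y => fderiv ℝ F y a) := by
  have hd : ∀ y : EuclideanSpace ℝ (Fin n), fderiv ℝ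
      (fun y : EuclideanSpace ℝ (Fin n) => Real.exp (-t * ‖y‖ ^ 2)) y a • F y
      = (-2 * t : ℂ) * (Real.exp (-t * ‖y‖ ^ 2) • (innerForm a y * F y)) := fun y => by
    rw [(hasFDerivAt_gaussian t y).fderiv]
    simp only [smul_apply, innerSL_apply_apply, innerForm_apply,
      Complex.real_smul, smul_eq_mul, nsmul_eq_mul, real_inner_comm y a]
    push_cast
    ring
  have key := integral_smul_fderiv_eq_neg_fderiv_smul_of_integrable
    (μ := (volume : Measure (EuclideanSpace ℝ (Fin n)))) (v := a)
    (f := fun y : EuclideanSpace ℝ (Fin n) => Real.exp (-t * ‖y‖ ^ 2)) (g := F)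
    (by
      simp only [hd]
      exact (((expGrowth_clm (innerForm a)).mul hF.2).integrable ht).const_mul _)
    ((hF.3 a).integrable ht) (hF.2.integrable ht)
    (fun y _ => (hasFDerivAt_gaussian t y).differentiableAt) (fun y _ => hF.1 y)
  simp only [hd] at key
  rw [integral_const_mul] at key
  have ht' : (t : ℂ) ≠ 0 := by exact_mod_cast ht.ne'
  simp only [gint]
  rw [key]
  field_simp

/-- Multiplying a homogeneous function by `|y|²` multiplies its Gaussian integral by an explicit
factor. -/
theorem gint_normSq_mul {t : ℝ} (ht : 0 < t) {F : EuclideanSpace ℝ (Fin n) → ℂ} (hF : Tame F)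
    {d : ℂ} (hd : ∀ y, fderiv ℝ F y y = d * F y) :
    gint t (fun y => ((‖y‖ ^ 2 : ℝ) : ℂ) * F y) = (2 * t : ℂ)⁻¹ * (n + d) * gint t F := by
  -- Write |y|² F = ∑ yᵢ (yᵢ F) and integrate by parts in each coordinate; by the Euler relation
  -- `hd`, ∑ ∂ᵢ(yᵢ F) = (n + d) F.
  let e : Fin n → EuclideanSpace ℝ (Fin n) := fun i => EuclideanSpace.single i 1
  have he : ∀ i y, innerForm (e i) y = ((y i : ℝ) : ℂ) := fun i y => by
    simp [e, EuclideanSpace.inner_single_left]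
  have hT : ∀ i, Tame (fun y => innerForm (e i) y * F y) := fun i => (tame_clm _).mul hF
  have hD : ∀ i y, fderiv ℝ (fun y => innerForm (e i) y * F y) y (e i)
      = innerForm (e i) y * fderiv ℝ F y (e i) + F y := fun i y => by
    rw [fderiv_fun_mul (innerForm (e i)).differentiableAt (hF.1 y)]
    simp [e]
  have h1 : (fun y : EuclideanSpace ℝ (Fin n) => ((‖y‖ ^ 2 : ℝ) : ℂ) * F y)
      = fun y => ∑ i, innerForm (e i) y * (innerForm (e i) y * F y) := by
    funext y
    rw [EuclideanSpace.real_norm_sq_eq, Complex.ofReal_sum, Finset.sum_mul]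
    refine Finset.sum_congr rfl fun i _ => ?_
    rw [he]
    push_cast
    ring
  have h2 : ∀ y, ∑ i, fderiv ℝ (fun y => innerForm (e i) y * F y) y (e i)
      = (n + d) * F y := fun y => by
    simp only [hD, Finset.sum_add_distrib]
    have hy : y = ∑ i, (y i) • e i := by
      ext j
      simp [e, Finset.sum_apply, Pi.single_apply]
    have : ∑ i, innerForm (e i) y * fderiv ℝ F y (e i) = fderiv ℝ F y y := by
      conv_rhs => arg 2; rw [hy]
      rw [map_sum]
      refine Finset.sum_congr rfl fun i _ => ?_
      rw [map_smul, he, Complex.real_smul]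
    rw [this, hd]
    simp
    ring
  rw [h1, gint_sum ht _ fun i _ => ((tame_clm _).mul (hT i)).2]
  simp only [gint_innerForm_mul ht (hT _)]
  rw [← Finset.mul_sum, ← gint_sum ht _ fun i _ => (hT i).3 _]
  simp only [h2]
  rw [gint_const_mul]
  ring

/-! ### Gaussian moments of ⟨x, y⟩^j z(y)^m. -/

/-- The complex linear form `y ↦ y₀ + i y₁`. -/
def zForm (hn : 2 ≤ n) : EuclideanSpace ℝ (Fin n) →L[ℝ] ℂ :=
  innerForm (EuclideanSpace.single ⟨0, by lia⟩ 1)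
    + Complex.I • innerForm (EuclideanSpace.single ⟨1, by lia⟩ 1)

theorem zForm_apply (hn : 2 ≤ n) (y : EuclideanSpace ℝ (Fin n)) :
    zForm hn y = (y ⟨0, by lia⟩ : ℂ) + Complex.I * (y ⟨1, by lia⟩ : ℂ) := by
  simp [zForm, EuclideanSpace.inner_single_left]

theorem tame_innerForm_pow_mul (hn : 2 ≤ n) (x : EuclideanSpace ℝ (Fin n)) (j m : ℕ) :
    Tame (fun y => innerForm x y ^ j * zForm hn y ^ m) :=
  ((tame_clm _).pow j).mul ((tame_clm _).pow m)

theorem fderiv_clm_pow (L : EuclideanSpace ℝ (Fin n) →L[ℝ] ℂ) (j : ℕ)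
    (y a : EuclideanSpace ℝ (Fin n)) :
    fderiv ℝ (fun y => L y ^ j) y a = j * L y ^ (j - 1) * L a := by
  rw [fderiv_fun_pow j L.differentiableAt]
  simp

theorem fderiv_innerForm_pow_mul (hn : 2 ≤ n) (x y a : EuclideanSpace ℝ (Fin n)) (j m : ℕ) :
    fderiv ℝ (fun y => innerForm x y ^ j * zForm hn y ^ m) y a
      = (j * innerForm x a) * (innerForm x y ^ (j - 1) * zForm hn y ^ m)
        + (m * zForm hn a) * (innerForm x y ^ j * zForm hn y ^ (m - 1)) := by
  rw [fderiv_fun_mul ((tame_clm _).pow j).1.differentiableAt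
    ((tame_clm _).pow m).1.differentiableAt]
  simp only [_root_.add_apply, _root_.smul_apply, smul_eq_mul, fderiv_clm_pow]
  ring

/-- The Gaussian moments `∫ exp (-t|y|²) ⟨x, y⟩^j z(y)^m dy`. -/
def moment (hn : 2 ≤ n) (t : ℝ) (x : EuclideanSpace ℝ (Fin n)) (j m : ℕ) : ℂ :=
  gint t (fun y => innerForm x y ^ j * zForm hn y ^ m)

/-- Integration by parts in the direction x. The truncated exponents `j - 1` and `m - 1` are
harmless, since at 0 their coefficients vanish. -/
theorem moment_succ (hn : 2 ≤ n) {t : ℝ} (ht : 0 < t) (x : EuclideanSpace ℝ (Fin n)) (j m : ℕ) :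
    moment hn t x (j + 1) m = (2 * t : ℂ)⁻¹ * (j * (‖x‖ ^ 2 : ℝ) * moment hn t x (j - 1) m
      + m * zForm hn x * moment hn t x j (m - 1)) := by
  have h := gint_innerForm_mul ht (tame_innerForm_pow_mul hn x j m) x
  simp only [fderiv_innerForm_pow_mul] at h
  rw [gint_add ht ((expGrowth_const _).mul (tame_innerForm_pow_mul hn x _ _).2)
    ((expGrowth_const _).mul (tame_innerForm_pow_mul hn x _ _).2), gint_const_mul,
    gint_const_mul] at h
  simp only [moment]
  rw [innerForm_apply, real_inner_self_eq_norm_sq] at h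
  rw [← h]
  congr 1
  funext y
  ring

/-- Splitting off one factor z = y₀ + i y₁ and integrating by parts, the two contributions cancel
because 1 + i² = 0. -/
theorem moment_zero_succ (hn : 2 ≤ n) {t : ℝ} (ht : 0 < t) (x : EuclideanSpace ℝ (Fin n))
    (m : ℕ) : moment hn t x 0 (m + 1) = 0 := by
  have hT := (tame_clm (zForm hn)).pow m
  have h0 := gint_innerForm_mul ht hT (EuclideanSpace.single ⟨0, by lia⟩ 1)
  have h1 := gint_innerForm_mul ht hT (EuclideanSpace.single ⟨1, by lia⟩ 1)
  have hz : (fun y => innerForm x y ^ 0 * zForm hn y ^ (m + 1)) = fun y =>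
      innerForm (EuclideanSpace.single ⟨0, by lia⟩ 1) y * zForm hn y ^ m
      + Complex.I * (innerForm (EuclideanSpace.single ⟨1, by lia⟩ 1) y * zForm hn y ^ m) := by
    funext y
    have : zForm hn y = innerForm (EuclideanSpace.single ⟨0, by lia⟩ 1) y
        + Complex.I * innerForm (EuclideanSpace.single ⟨1, by lia⟩ 1) y := rfl
    rw [pow_succ, pow_zero, one_mul]
    linear_combination zForm hn y ^ m * this
  rw [moment, hz, gint_add ht ((tame_clm _).mul hT).2
    ((expGrowth_const _).mul ((tame_clm _).mul hT).2), gint_const_mul, h0, h1]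
  simp only [fderiv_clm_pow]
  have e0 : zForm hn (EuclideanSpace.single ⟨0, by lia⟩ 1) = 1 := by
    simp [zForm_apply]
  have e1 : zForm hn (EuclideanSpace.single ⟨1, by lia⟩ 1) = Complex.I := by
    simp [zForm_apply]
  rw [e0, e1]
  simp only [mul_comm _ Complex.I, gint_const_mul, mul_one]
  linear_combination (2 * (t : ℂ))⁻¹ * m * gint t (fun y => zForm hn y ^ (m - 1))
    * Complex.I_mul_I

/-- The recursion lowers j by 2, or j and m by 1 each, and only (0, 0) is a nonzero terminal value;
it is reached only from j = m + 2i. -/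
theorem moment_eq_zero (hn : 2 ≤ n) {t : ℝ} (ht : 0 < t) (x : EuclideanSpace ℝ (Fin n))
    (j m : ℕ) (h : ∀ i, j ≠ m + 2 * i) : moment hn t x j m = 0 := by
  induction j using Nat.strong_induction_on generalizing m with
  | _ j ih =>
    rcases j with _ | j
    · rcases m with _ | m
      · exact absurd rfl (h 0)
      · exact moment_zero_succ hn ht x m
    · rw [moment_succ hn ht]
      have h1 : (j : ℂ) * moment hn t x (j - 1) m = 0 := by
        rcases j with _ | j
        · simp
        · rw [Nat.add_sub_cancel, ih j (by lia) m fun i hi => h (i + 1) (by lia), mul_zero]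
      have h2 : (m : ℂ) * moment hn t x j (m - 1) = 0 := by
        rcases m with _ | m
        · simp
        · rw [Nat.add_sub_cancel, ih j (by lia) m fun i hi => h i (by lia), mul_zero]
      linear_combination (2 * t : ℂ)⁻¹ * (((‖x‖ ^ 2 : ℝ) : ℂ) * h1 + zForm hn x * h2)

theorem moment_eq (hn : 2 ≤ n) {t : ℝ} (ht : 0 < t) (x : EuclideanSpace ℝ (Fin n))
    (m i : ℕ) : moment hn t x (m + 2 * i) m =
      moment hn t x 0 0 * (m + 2 * i).factorial / (i.factorial * 2 ^ (m + 2 * i) * t ^ (m + i))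
        * (‖x‖ ^ 2 : ℝ) ^ i * zForm hn x ^ m := by
  have ht' : (t : ℂ) ≠ 0 := by exact_mod_cast ht.ne'
  suffices ∀ N, ∀ m i, m + 2 * i = N → moment hn t x (m + 2 * i) m =
      moment hn t x 0 0 * (m + 2 * i).factorial / (i.factorial * 2 ^ (m + 2 * i) * t ^ (m + i))
        * (‖x‖ ^ 2 : ℝ) ^ i * zForm hn x ^ m from this _ m i rfl
  intro N
  induction N using Nat.strong_induction_on with
  | _ N ih =>
    intro m i hN
    have hf : ∀ k : ℕ, (k.factorial : ℂ) ≠ 0 := fun k => by exact_mod_cast k.factorial_ne_zero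
    rcases m with _ | m
    · rcases i with _ | i
      · simp
      · have := ih (0 + 2 * i) (by lia) 0 i rfl
        rw [show 0 + 2 * (i + 1) = (0 + 2 * i + 1) + 1 by ring, moment_succ hn ht,
          Nat.add_sub_cancel, this, Nat.factorial_succ (0 + 2 * i + 1),
          Nat.factorial_succ (0 + 2 * i), Nat.factorial_succ i]
        have := hf i
        have : (i : ℂ) + 1 ≠ 0 := by exact_mod_cast i.succ_ne_zero
        push_cast
        field_simp
        ring
    · have h2 := ih (m + 2 * i) (by lia) m i rfl
      rcases i with _ | i
      -- Here j = m, so the term with j lowered by 2 has fewer factors ⟨x, y⟩ than z and vanishes.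
      · have h1 : ((m : ℂ)) * moment hn t x (m - 1) (m + 1) = 0 := by
          rw [moment_eq_zero hn ht x _ _ (by lia), mul_zero]
        simp only [mul_zero, add_zero] at h2 ⊢
        rw [moment_succ hn ht, Nat.add_sub_cancel, h2, Nat.factorial_succ]
        have := hf m
        rw [show (m : ℂ) * ((‖x‖ ^ 2 : ℝ) : ℂ) * moment hn t x (m - 1) (m + 1) = 0 by
          linear_combination ((‖x‖ ^ 2 : ℝ) : ℂ) * h1]
        push_cast
        field_simp
        ring
      · have h1 := ih (m + 1 + 2 * i) (by lia) (m + 1) i rfl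
        rw [show m + 1 + 2 * (i + 1) = (m + 2 * (i + 1)) + 1 by ring, moment_succ hn ht,
          Nat.add_sub_cancel, h2, show m + 2 * (i + 1) - 1 = m + 1 + 2 * i by lia, h1,
          Nat.factorial_succ (m + 2 * (i + 1)), show m + 2 * (i + 1) = (m + 1 + 2 * i) + 1 by ring,
          Nat.factorial_succ (m + 1 + 2 * i), Nat.factorial_succ i]
        have := hf i
        have := hf (m + 1 + 2 * i)
        have : (i : ℂ) + 1 ≠ 0 := by exact_mod_cast i.succ_ne_zero
        push_cast
        field_simp
        ring

/-- Gaussian moments with an additional factor `|y|^(2l)`. -/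
theorem gint_normSq_pow_mul (hn : 2 ≤ n) {t : ℝ} (ht : 0 < t) (x : EuclideanSpace ℝ (Fin n))
    (j m l : ℕ) :
    gint t (fun y => ((‖y‖ ^ 2 : ℝ) : ℂ) ^ l * (innerForm x y ^ j * zForm hn y ^ m))
      = (2 * t : ℂ)⁻¹ ^ l * (∏ q ∈ Finset.range l, ((n : ℂ) + (j + m) + 2 * q))
        * moment hn t x j m := by
  induction l with
  | zero => simp [moment]
  | succ l ih =>
    have hT := (tame_normSq (n := n).pow l).mul (tame_innerForm_pow_mul hn x j m)
    -- The integrand is homogeneous of degree j + m + 2l, which gives the next factor of the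
    -- product.
    have h := gint_normSq_mul ht hT (d := (j + m) + 2 * l) fun y => by
      rw [fderiv_fun_mul (tame_normSq.pow l).1.differentiableAt
        (tame_innerForm_pow_mul hn x j m).1.differentiableAt,
        fderiv_fun_pow l tame_normSq.1.differentiableAt]
      simp only [_root_.add_apply, _root_.smul_apply, smul_eq_mul, fderiv_innerForm_pow_mul,
        fderiv_normSq]
      rw [innerForm_apply y y, real_inner_self_eq_norm_sq]
      rcases l with _ | l <;> rcases j with _ | j <;> rcases m with _ | m <;>
        simp <;> ring
    rw [ih] at h
    rw [Finset.prod_range_succ, pow_succ (2 * t : ℂ)⁻¹]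
    have h3 : (fun y => ((‖y‖ ^ 2 : ℝ) : ℂ) ^ (l + 1) * (innerForm x y ^ j * zForm hn y ^ m))
        = fun y => ((‖y‖ ^ 2 : ℝ) : ℂ) *
          (((‖y‖ ^ 2 : ℝ) : ℂ) ^ l * (innerForm x y ^ j * zForm hn y ^ m)) := by
      funext y
      ring
    rw [h3, h]
    ring

/-! ### Zonal harmonics integrated against z^m. -/

/-- The coefficients of the zonal harmonic of degree `m`. -/
def zonalCoeff (n m k : ℕ) : ℝ :=
  (-1) ^ k * (∏ j ∈ Finset.range (m - k - 1), ((n : ℝ) + 2 * j))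
      / (2 ^ k * (k.factorial : ℝ) * ((m - 2 * k).factorial : ℝ))

theorem zonalExt_zero (x y : EuclideanSpace ℝ (Fin n)) : zonalExt 0 x y = 1 := by
  simp [zonalExt, zonal]

/-- The factor |y|^m clears the normalisation of the pole, leaving a polynomial in y. At y = 0 every
term vanishes because m > 0. -/
theorem zonalExt_eq {m : ℕ} (hm : m ≠ 0) (x y : EuclideanSpace ℝ (Fin n)) :
    zonalExt m x y = ∑ k ∈ Finset.range (m / 2 + 1), ((n : ℝ) + 2 * m - 2) * zonalCoeff n m k
      * (inner ℝ x y ^ (m - 2 * k) * ‖x‖ ^ (2 * k) * ‖y‖ ^ (2 * k)) := by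
  rw [zonalExt, zonal, if_neg hm, Finset.mul_sum, Finset.mul_sum]
  refine Finset.sum_congr rfl fun k hk => ?_
  rw [← zonalCoeff]
  have hk' : 2 * k ≤ m := by
    have := Finset.mem_range.1 hk
    lia
  rcases eq_or_ne y 0 with rfl | hy
  · simp only [norm_zero, inner_zero_right, smul_zero, zero_pow hm, zero_mul]
    rcases Nat.eq_zero_or_pos k with rfl | h
    · simp [hm]
    · simp [h.ne']
  · have hy' : ‖y‖ ≠ 0 := norm_ne_zero_iff.2 hy
    rw [inner_smul_right, mul_pow]
    have : ‖y‖ ^ m = ‖y‖ ^ (m - 2 * k) * ‖y‖ ^ (2 * k) := by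
      rw [← pow_add]
      congr 1
      lia
    rw [this]
    have h1 : ‖y‖ ^ (m - 2 * k) * ‖y‖⁻¹ ^ (m - 2 * k) = 1 := by
      rw [← mul_pow, mul_inv_cancel₀ hy', one_pow]
    linear_combination ‖y‖ ^ (2 * k) * (((n : ℝ) + 2 * m - 2) * zonalCoeff n m k
      * inner ℝ x y ^ (m - 2 * k) * ‖x‖ ^ (2 * k)) * h1

theorem continuous_zonalExt (m : ℕ) (x : EuclideanSpace ℝ (Fin n)) :
    Continuous (fun y => zonalExt m x y) := by
  rcases eq_or_ne m 0 with rfl | hm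
  · simp only [zonalExt_zero]
    exact continuous_const
  · simp only [zonalExt_eq hm]
    fun_prop

/-- The product is a polynomial in l of degree at most i - 1, and the sum is (-1)^i / i! times its
i-th finite difference at 0. -/
theorem sum_alternating_mul_prod_eq_zero (a : ℂ) {i : ℕ} (hi : i ≠ 0) :
    ∑ l ∈ Finset.range (i + 1), (-1 : ℂ) ^ l / (l.factorial * (i - l).factorial)
      * ∏ r ∈ Finset.range (i - 1), (a - 2 * l + 2 * r) = 0 := by
  let P : Polynomial ℂ := ∏ r ∈ Finset.range (i - 1),
    (Polynomial.C (a + 2 * r) - Polynomial.C 2 * Polynomial.X)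
  have hP : P.natDegree < i := by
    have h : P.natDegree ≤ ∑ r ∈ Finset.range (i - 1), 1 := by
      refine (Polynomial.natDegree_prod_le _ _).trans (Finset.sum_le_sum fun r _ => ?_)
      refine (Polynomial.natDegree_sub_le _ _).trans (max_le
        ((Polynomial.natDegree_C _).le.trans zero_le_one) ?_)
      exact Polynomial.natDegree_C_mul_le _ _ |>.trans (by simp)
    simp only [Finset.sum_const, Finset.card_range, smul_eq_mul, mul_one] at h
    lia
  have h := congrFun (Polynomial.fwdDiff_iter_eq_zero_of_degree_lt hP) 0
  rw [fwdDiff_iter_eq_sum_shift] at h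
  have hc : ((-1 : ℂ) ^ i / i.factorial) * (∑ k ∈ Finset.range (i + 1),
      ((-1 : ℤ) ^ (i - k) * i.choose k) • P.eval (0 + k • (1 : ℂ))) = 0 := by
    rw [h]
    simp
  rw [← hc, Finset.mul_sum]
  refine Finset.sum_congr rfl fun l hl => ?_
  have hl' : l ≤ i := by
    have := Finset.mem_range.1 hl
    lia
  have hev : P.eval (0 + l • (1 : ℂ)) = ∏ r ∈ Finset.range (i - 1), (a - 2 * l + 2 * r) := by
    simp only [P, Polynomial.eval_prod]
    refine Finset.prod_congr rfl fun r _ => ?_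
    simp
    ring
  have hs : (-1 : ℂ) ^ i = (-1) ^ l * (-1) ^ (i - l) := by
    rw [← pow_add]
    congr 1
    lia
  have hs2 : (-1 : ℂ) ^ (i - l) * (-1) ^ (i - l) = 1 := by
    rw [← mul_pow]
    simp
  have hf : ∀ k : ℕ, (k.factorial : ℂ) ≠ 0 := fun k => by exact_mod_cast k.factorial_ne_zero
  have hch : (i.choose l : ℂ) = i.factorial / (l.factorial * (i - l).factorial) := by
    rw [Nat.cast_choose ℂ hl']
  rw [hev, zsmul_eq_mul]
  push_cast
  rw [hch, hs]
  have := hf i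
  have := hf l
  have := hf (i - l)
  field_simp
  linear_combination -(∏ r ∈ Finset.range (i - 1), (a - 2 * l + 2 * r)) * hs2

/-- The second product on the left continues the progression from index m + i - l to m + i.
Exchanging tails isolates a factor free of l and leaves a polynomial in l of degree i - 1. -/
theorem prod_mul_prod_shift (a : ℂ) {m i l : ℕ} (hi : i ≠ 0) (hl : l ≤ i) :
    (∏ q ∈ Finset.range (m + 2 * i - l - 1), (a + 2 * q))
      * ∏ q ∈ Finset.range l, (a + ((m + 2 * i - 2 * l : ℕ) + m) + 2 * q)
    = (∏ q ∈ Finset.range (m + i), (a + 2 * q))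
      * ∏ r ∈ Finset.range (i - 1), (a + 2 * m + 2 * i - 2 * l + 2 * r) := by
  have h1 := Finset.prod_range_add (fun q : ℕ => a + 2 * (q : ℂ)) (m + i - l) (i - 1)
  have h2 := Finset.prod_range_add (fun q : ℕ => a + 2 * (q : ℂ)) (m + i - l) l
  rw [show m + i - l + (i - 1) = m + 2 * i - l - 1 by lia] at h1
  rw [show m + i - l + l = m + i by lia] at h2
  rw [h1, h2]
  have e1 : ∀ r : ℕ, a + 2 * ((m + i - l + r : ℕ) : ℂ) = a + 2 * m + 2 * i - 2 * l + 2 * r :=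
    fun r => by
      push_cast [Nat.cast_sub (show l ≤ m + i by lia)]
      ring
  have e2 : ∀ q : ℕ, a + ((m + 2 * i - 2 * l : ℕ) + m) + 2 * q
      = a + 2 * m + 2 * i - 2 * l + 2 * q :=
    fun r => by
      push_cast [Nat.cast_sub (show 2 * l ≤ m + 2 * i by lia)]
      ring
  simp only [e1, e2]
  ring

theorem gint_zonalExt_eq_sum (hn : 2 ≤ n) {t : ℝ} (ht : 0 < t) (x : EuclideanSpace ℝ (Fin n))
    {k : ℕ} (hk : k ≠ 0) (m : ℕ) :
    gint t (fun y => (zonalExt k x y : ℂ) * zForm hn y ^ m)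
      = ∑ l ∈ Finset.range (k / 2 + 1), ((((n : ℝ) + 2 * k - 2) * zonalCoeff n k l
        * ‖x‖ ^ (2 * l) : ℝ) : ℂ) * ((2 * t : ℂ)⁻¹ ^ l
        * (∏ q ∈ Finset.range l, ((n : ℂ) + ((k - 2 * l : ℕ) + m) + 2 * q))
        * moment hn t x (k - 2 * l) m) := by
  have h : (fun y => (zonalExt k x y : ℂ) * zForm hn y ^ m) = fun y =>
      ∑ l ∈ Finset.range (k / 2 + 1), ((((n : ℝ) + 2 * k - 2) * zonalCoeff n k l
        * ‖x‖ ^ (2 * l) : ℝ) : ℂ) * (((‖y‖ ^ 2 : ℝ) : ℂ) ^ l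
          * (innerForm x y ^ (k - 2 * l) * zForm hn y ^ m)) := by
    funext y
    rw [zonalExt_eq hk, Complex.ofReal_sum, Finset.sum_mul]
    refine Finset.sum_congr rfl fun l _ => ?_
    rw [innerForm_apply]
    push_cast
    ring
  rw [h, gint_sum ht _ fun l _ => (expGrowth_const _).mul
    ((tame_normSq.pow l).mul (tame_innerForm_pow_mul hn x _ _)).2]
  refine Finset.sum_congr rfl fun l _ => ?_
  rw [gint_const_mul, gint_normSq_pow_mul hn ht]

/-- Orthogonality of different degrees. If k = m + 2i with i > 0, inserting the closed moments turns
the sum over l into a multiple of the alternating sum above; otherwise every moment vanishes. -/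
theorem gint_zonalExt_of_ne (hn : 2 ≤ n) {t : ℝ} (ht : 0 < t) (x : EuclideanSpace ℝ (Fin n))
    {k m : ℕ} (hkm : k ≠ m) : gint t (fun y => (zonalExt k x y : ℂ) * zForm hn y ^ m) = 0 := by
  rcases eq_or_ne k 0 with rfl | hk
  · simp only [zonalExt_zero]
    have := moment_eq_zero hn ht x 0 m (by lia)
    simpa [moment] using this
  rw [gint_zonalExt_eq_sum hn ht x hk]
  by_cases hex : ∃ i, k = m + 2 * i
  swap
  · refine Finset.sum_eq_zero fun l hl => ?_
    have := Finset.mem_range.1 hl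
    rw [moment_eq_zero hn ht x _ m fun i hi => hex ⟨i + l, by lia⟩]
    simp
  obtain ⟨i, rfl⟩ := hex
  have hi : i ≠ 0 := by
    rintro rfl
    simp at hkm
  -- For l > i the exponent k - 2l is below m, so these moments vanish.
  have hsub : Finset.range (i + 1) ⊆ Finset.range ((m + 2 * i) / 2 + 1) :=
    Finset.range_subset_range.2 (by lia)
  rw [← Finset.sum_subset hsub fun l hl hl' => by
    have h1 := Finset.mem_range.1 hl
    have h2 : ¬ l < i + 1 := fun h => hl' (Finset.mem_range.2 h)
    rw [moment_eq_zero hn ht x _ m fun i hi => by lia]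
    simp]
  have hs := sum_alternating_mul_prod_eq_zero ((n : ℂ) + 2 * m + 2 * i) hi
  have ht' : (t : ℂ) ≠ 0 := by exact_mod_cast ht.ne'
  have hz := congrArg (fun w => ((n : ℂ) + 2 * (m + 2 * i : ℕ) - 2) * (‖x‖ ^ 2 : ℝ) ^ i
    * zForm hn x ^ m * moment hn t x 0 0 / (2 ^ (m + 2 * i) * t ^ (m + i))
    * (∏ q ∈ Finset.range (m + i), ((n : ℂ) + 2 * q)) * w) hs
  simp only [mul_zero] at hz
  rw [← hz, Finset.mul_sum]
  refine Finset.sum_congr rfl fun l hl => ?_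
  have hl' : l ≤ i := by
    have := Finset.mem_range.1 hl
    lia
  have hp := prod_mul_prod_shift (n : ℂ) (m := m) hi hl'
  have hm := moment_eq hn ht x m (i - l)
  rw [show m + 2 * (i - l) = m + 2 * i - 2 * l by lia] at hm
  rw [hm]
  have hf : ∀ k : ℕ, (k.factorial : ℂ) ≠ 0 := fun k => by exact_mod_cast k.factorial_ne_zero
  have e1 : (2 : ℂ) ^ (m + 2 * i) = 2 ^ (m + 2 * i - 2 * l) * 2 ^ (2 * l) := by
    rw [← pow_add]
    congr 1
    lia
  have e2 : (t : ℂ) ^ (m + i) = t ^ (m + (i - l)) * t ^ l := by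
    rw [← pow_add]
    congr 1
    lia
  have e3 : ((‖x‖ ^ 2 : ℝ) : ℂ) ^ i = ((‖x‖ ^ 2 : ℝ) : ℂ) ^ (i - l) * ((‖x‖ ^ 2 : ℝ) : ℂ) ^ l := by
    rw [← pow_add]
    congr 1
    lia
  have e4 : ((‖x‖ ^ (2 * l) : ℝ) : ℂ) = ((‖x‖ ^ 2 : ℝ) : ℂ) ^ l := by
    push_cast
    ring
  rw [e1, e2, e3]
  rw [Complex.ofReal_mul, e4]
  generalize ((‖x‖ ^ 2 : ℝ) : ℂ) = X
  have := hf l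
  have := hf (i - l)
  have := hf (m + 2 * i - 2 * l)
  simp only [zonalCoeff]
  push_cast
  rw [show (2 : ℂ) ^ (2 * l) = 2 ^ l * 2 ^ l by ring, inv_pow, mul_pow]
  field_simp
  linear_combination ((n : ℂ) + 2 * (m + 2 * i) - 2) * X ^ l * X ^ (i - l)
    * moment hn t x 0 0 * zForm hn x ^ m * hp

theorem ascPochhammer_half_eq (n m : ℕ) :
    (ascPochhammer ℝ m).eval ((n : ℝ) / 2)
      = (∏ q ∈ Finset.range m, ((n : ℝ) + 2 * q)) / 2 ^ m := by
  induction m with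
  | zero => simp
  | succ m ih =>
    rw [ascPochhammer_succ_eval, ih, Finset.prod_range_succ, pow_succ]
    field_simp

/-- Only l = 0 survives. The prefactor n + 2m - 2 is the missing last factor of 2^m (n/2)_m. -/
theorem gint_zonalExt_self (hn : 2 ≤ n) {t : ℝ} (ht : 0 < t) (x : EuclideanSpace ℝ (Fin n))
    (m : ℕ) : gint t (fun y => (zonalExt m x y : ℂ) * zForm hn y ^ m)
      = moment hn t x 0 0 * ((ascPochhammer ℝ m).eval ((n : ℝ) / 2) / t ^ m : ℝ)
        * zForm hn x ^ m := by
  rcases eq_or_ne m 0 with rfl | hm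
  · simp [zonalExt_zero, moment]
  rw [gint_zonalExt_eq_sum hn ht x hm, Finset.sum_eq_single 0]
  · have h := moment_eq hn ht x m 0
    simp only [mul_zero, add_zero] at h
    simp only [mul_zero, Nat.sub_zero, Finset.range_zero, Finset.prod_empty, pow_zero, mul_one, h,
      zonalCoeff, ascPochhammer_half_eq]
    obtain ⟨m, rfl⟩ := Nat.exists_eq_succ_of_ne_zero hm
    rw [Nat.succ_eq_add_one, Nat.add_sub_cancel, Finset.prod_range_succ]
    have : ((m + 1).factorial : ℂ) ≠ 0 := by exact_mod_cast (m + 1).factorial_ne_zero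
    have ht' : (t : ℂ) ≠ 0 := by exact_mod_cast ht.ne'
    push_cast
    simp only [Nat.factorial_zero, Nat.cast_one]
    field_simp
    ring
  · intro l hl hl0
    have := Finset.mem_range.1 hl
    rw [moment_eq_zero hn ht x _ m fun i hi => by lia]
    simp
  · simp

/-! ### Growth bounds and convergence of the kernel series. -/

/-- A crude factorial estimate that supplies the 1/k! in the bound on the zonal coefficients
relative to (n/2)_k. -/
theorem factorial_le_prod (hn : 2 ≤ n) {k l : ℕ} (hk : k ≠ 0) (hl : 2 * l ≤ k) :
    (k.factorial : ℝ) ≤ 4 ^ k * (∏ x ∈ Finset.range l, ((n : ℝ) + 2 * (k - l - 1 + x : ℕ)))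
      * (2 ^ l * l.factorial * (k - 2 * l).factorial) := by
  set D := ∏ x ∈ Finset.range l, ((n : ℝ) + 2 * (k - l - 1 + x : ℕ)) with hD
  have hD1 : (((k - l - 1 + 1).ascFactorial l : ℕ) : ℝ) ≤ D := by
    rw [Nat.ascFactorial_eq_prod_range, Nat.cast_prod]
    refine Finset.prod_le_prod (fun _ _ => Nat.cast_nonneg _) fun x _ => ?_
    have : (2 : ℝ) ≤ n := by exact_mod_cast hn
    push_cast
    nlinarith [Nat.cast_nonneg (α := ℝ) (k - l - 1), Nat.cast_nonneg (α := ℝ) x]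
  have hD0 : 0 ≤ D := le_trans (Nat.cast_nonneg _) hD1
  have h1 : (k - l - 1).factorial * (k - l - 1 + 1).ascFactorial l = (k - 1).factorial := by
    rw [Nat.factorial_mul_ascFactorial]
    congr 1
    lia
  have h2 : (k - l).factorial ≤ 2 ^ k * l.factorial * (k - 2 * l).factorial := by
    have h := Nat.choose_mul_factorial_mul_factorial (show l ≤ k - l by lia)
    rw [show k - l - l = k - 2 * l by lia] at h
    rw [← h]
    gcongr
    exact (Nat.choose_le_two_pow _ _).trans (Nat.pow_le_pow_right (by norm_num) (by lia))
  have h3 : k.factorial ≤ 2 ^ k * (k - 1).factorial := by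
    rw [← Nat.mul_factorial_pred hk]
    gcongr
    exact k.lt_two_pow_self.le
  have h4 : (k - l - 1).factorial ≤ (k - l).factorial := Nat.factorial_le (by lia)
  have h5 : (k.factorial : ℝ) ≤ 2 ^ k * (((k - l - 1).factorial : ℝ)
      * ((k - l - 1 + 1).ascFactorial l : ℕ)) := by
    rw [← h1] at h3
    exact_mod_cast h3
  calc (k.factorial : ℝ) ≤ 2 ^ k * (((k - l - 1).factorial : ℝ)
      * ((k - l - 1 + 1).ascFactorial l : ℕ)) := h5
    _ ≤ 2 ^ k * ((2 ^ k * l.factorial * (k - 2 * l).factorial) * D) := by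
      gcongr
      exact_mod_cast h4.trans h2
    _ = 4 ^ k * D * (1 * l.factorial * (k - 2 * l).factorial) := by
      rw [show (4 : ℝ) = 2 * 2 by norm_num, mul_pow]
      ring
    _ ≤ _ := by
      gcongr
      exact one_le_pow₀ (by norm_num)

theorem ascPochhammer_half_pos (hn : 2 ≤ n) (k : ℕ) :
    0 < (ascPochhammer ℝ k).eval ((n : ℝ) / 2) :=
  ascPochhammer_pos k _ (by
    have : (2 : ℝ) ≤ n := by exact_mod_cast hn
    linarith)

/-- The numerator and n + 2k - 2 are factors of ∏ (n + 2q) = 2^k (n/2)_k; the l leftover factors are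
bounded below by `factorial_le_prod`. Here 8 = 4 · 2. -/
theorem abs_zonalCoeff_le (hn : 2 ≤ n) {k l : ℕ} (hk : k ≠ 0) (hl : 2 * l ≤ k) :
    ((n : ℝ) + 2 * k - 2) * |zonalCoeff n k l|
      ≤ 8 ^ k / k.factorial * (ascPochhammer ℝ k).eval ((n : ℝ) / 2) := by
  set A := ∏ j ∈ Finset.range (k - l - 1), ((n : ℝ) + 2 * j) with hA
  have hA0 : 0 ≤ A := Finset.prod_nonneg fun _ _ => by positivity
  have hsplit : ∏ q ∈ Finset.range k, ((n : ℝ) + 2 * q)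
      = A * (∏ x ∈ Finset.range l, ((n : ℝ) + 2 * (k - l - 1 + x : ℕ)))
        * ((n : ℝ) + 2 * k - 2) := by
    conv_lhs => rw [show k = (k - l - 1 + l) + 1 by lia]
    rw [Finset.prod_range_succ, Finset.prod_range_add]
    congr 1
    rw [show k - l - 1 + l = k - 1 by lia, Nat.cast_sub (by lia)]
    push_cast
    ring
  have hc : |zonalCoeff n k l| = A / (2 ^ l * l.factorial * (k - 2 * l).factorial) := by
    rw [zonalCoeff, abs_div, abs_mul, abs_pow, abs_neg, abs_one, one_pow, one_mul,
      abs_of_nonneg hA0, abs_of_nonneg (by positivity)]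
  have hnk : 0 ≤ (n : ℝ) + 2 * k - 2 := by
    have : (2 : ℝ) ≤ n := by exact_mod_cast hn
    have : (0 : ℝ) ≤ k := Nat.cast_nonneg _
    linarith
  have key := factorial_le_prod hn hk hl
  set D := ∏ x ∈ Finset.range l, ((n : ℝ) + 2 * (k - l - 1 + x : ℕ)) with hD
  set Q : ℝ := 2 ^ l * l.factorial * (k - 2 * l).factorial with hQ
  have hQ0 : 0 < Q := by positivity
  have hf : (0 : ℝ) < k.factorial := by positivity
  rw [hc, ascPochhammer_half_eq, hsplit]
  have h8 : (8 : ℝ) ^ k = 4 ^ k * 2 ^ k := by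
    rw [← mul_pow]
    norm_num
  rw [h8]
  calc ((n : ℝ) + 2 * k - 2) * (A / Q)
      = ((n : ℝ) + 2 * k - 2) * A * k.factorial / (k.factorial * Q) := by field_simp
    _ ≤ ((n : ℝ) + 2 * k - 2) * A * (4 ^ k * D * Q) / (k.factorial * Q) := by gcongr
    _ = _ := by field_simp

/-- Cauchy–Schwarz bounds each term, and the at most 2^k terms turn 8 into 16. -/
theorem abs_zonalExt_le (hn : 2 ≤ n) (k : ℕ) (x y : EuclideanSpace ℝ (Fin n)) :
    |zonalExt k x y| ≤ (16 * (‖x‖ * ‖y‖)) ^ k / k.factorial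
      * (ascPochhammer ℝ k).eval ((n : ℝ) / 2) := by
  rcases eq_or_ne k 0 with rfl | hk
  · simp [zonalExt_zero]
  rw [zonalExt_eq hk]
  have hnk : 0 ≤ (n : ℝ) + 2 * k - 2 := by
    have : (2 : ℝ) ≤ n := by exact_mod_cast hn
    have : (0 : ℝ) ≤ k := Nat.cast_nonneg _
    linarith
  have hp := ascPochhammer_half_pos hn k
  refine (Finset.abs_sum_le_sum_abs _ _).trans ?_
  have hterm : ∀ l ∈ Finset.range (k / 2 + 1), |((n : ℝ) + 2 * k - 2) * zonalCoeff n k l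
      * (inner ℝ x y ^ (k - 2 * l) * ‖x‖ ^ (2 * l) * ‖y‖ ^ (2 * l))|
      ≤ 8 ^ k / k.factorial * (ascPochhammer ℝ k).eval ((n : ℝ) / 2) * (‖x‖ * ‖y‖) ^ k := by
    intro l hl
    have hl' : 2 * l ≤ k := by
      have := Finset.mem_range.1 hl
      lia
    rw [abs_mul, abs_mul, abs_of_nonneg hnk]
    refine mul_le_mul (abs_zonalCoeff_le hn hk hl') ?_ (abs_nonneg _) (by positivity)
    rw [abs_mul, abs_mul, abs_pow, abs_of_nonneg (show 0 ≤ ‖x‖ ^ (2 * l) by positivity),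
      abs_of_nonneg (show 0 ≤ ‖y‖ ^ (2 * l) by positivity), mul_assoc, ← mul_pow]
    calc |inner ℝ x y| ^ (k - 2 * l) * (‖x‖ * ‖y‖) ^ (2 * l)
        ≤ (‖x‖ * ‖y‖) ^ (k - 2 * l) * (‖x‖ * ‖y‖) ^ (2 * l) := by
          gcongr
          exact abs_real_inner_le_norm x y
      _ = (‖x‖ * ‖y‖) ^ k := by
          rw [← pow_add]
          congr 1
          lia
  refine (Finset.sum_le_sum hterm).trans ?_
  rw [Finset.sum_const, Finset.card_range, nsmul_eq_mul]
  have hcard : ((k / 2 + 1 : ℕ) : ℝ) ≤ 2 ^ k := by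
    have := k.lt_two_pow_self
    have h : k / 2 + 1 ≤ 2 ^ k := by lia
    exact_mod_cast h
  calc ((k / 2 + 1 : ℕ) : ℝ) * (8 ^ k / k.factorial * (ascPochhammer ℝ k).eval ((n : ℝ) / 2)
        * (‖x‖ * ‖y‖) ^ k)
      ≤ 2 ^ k * (8 ^ k / k.factorial * (ascPochhammer ℝ k).eval ((n : ℝ) / 2)
        * (‖x‖ * ‖y‖) ^ k) := by gcongr
    _ = _ := by
      rw [show (16 : ℝ) = 2 * 8 by norm_num, mul_pow (2 * 8), mul_pow 2 8]
      ring

theorem abs_kernel_term_le (hn : 2 ≤ n) {α : ℝ} (hα : 0 < α) (k : ℕ)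
    (x y : EuclideanSpace ℝ (Fin n)) :
    |zonalExt k x y / (α ^ k * (ascPochhammer ℝ k).eval ((n : ℝ) / 2))|
      ≤ (16 * ‖x‖ / α * ‖y‖) ^ k / k.factorial := by
  have hp := ascPochhammer_half_pos hn k
  rw [abs_div, abs_of_pos (show 0 < α ^ k * _ by positivity), div_le_iff₀ (by positivity)]
  refine (abs_zonalExt_le hn k x y).trans (le_of_eq ?_)
  simp only [mul_pow, div_pow]
  field_simp

theorem hasSum_kernel (hn : 2 ≤ n) {α : ℝ} (hα : 0 < α) (x y : EuclideanSpace ℝ (Fin n)) :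
    HasSum (fun k => zonalExt k x y / (α ^ k * (ascPochhammer ℝ k).eval ((n : ℝ) / 2)))
      (kernel α x y) :=
  (Summable.of_norm_bounded (Real.summable_pow_div_factorial _)
    (fun k => abs_kernel_term_le hn hα k x y)).hasSum

theorem abs_kernel_le (hn : 2 ≤ n) {α : ℝ} (hα : 0 < α) (x y : EuclideanSpace ℝ (Fin n)) :
    |kernel α x y| ≤ Real.exp (16 * ‖x‖ / α * ‖y‖) := by
  have h : HasSum (fun k : ℕ => (16 * ‖x‖ / α * ‖y‖) ^ k / k.factorial)
      (Real.exp (16 * ‖x‖ / α * ‖y‖)) := by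
    rw [Real.exp_eq_exp_ℝ]
    exact NormedSpace.expSeries_div_hasSum_exp _
  exact (hasSum_kernel hn hα x y).norm_le_of_bounded h (fun k => abs_kernel_term_le hn hα k x y)

theorem aestronglyMeasurable_kernel (hn : 2 ≤ n) {α : ℝ} (hα : 0 < α)
    (x : EuclideanSpace ℝ (Fin n)) : AEStronglyMeasurable (fun y => kernel α x y) volume := by
  refine aestronglyMeasurable_of_tendsto_ae Filter.atTop
    (f := fun N y => ∑ k ∈ Finset.range N,
      zonalExt k x y / (α ^ k * (ascPochhammer ℝ k).eval ((n : ℝ) / 2))) (fun N => ?_)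
    (Filter.Eventually.of_forall fun y => (hasSum_kernel hn hα x y).tendsto_sum_nat)
  exact (continuous_finsetSum _ fun k _ =>
    (continuous_zonalExt k x).div_const _).aestronglyMeasurable

/-! ### The kernel applied to Gaussian-weighted powers of z. -/

theorem expGrowth_exp_mul (B : ℝ) :
    ExpGrowth (fun y : EuclideanSpace ℝ (Fin n) => ((Real.exp (B * ‖y‖) : ℝ) : ℂ)) :=
  ⟨by fun_prop, 1, B, fun y => by
    rw [Complex.norm_real, Real.norm_of_nonneg (Real.exp_pos _).le, one_mul]⟩

theorem integrable_exp_mul_zForm_pow (hn : 2 ≤ n) {t : ℝ} (ht : 0 < t) (B : ℝ) (m : ℕ) :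
    Integrable (fun y => Real.exp (B * ‖y‖) * (Real.exp (-t * ‖y‖ ^ 2) * ‖zForm hn y ^ m‖)) := by
  refine (((expGrowth_exp_mul B).mul ((tame_clm (zForm hn)).pow m).2).integrable ht).norm.congr
    (Filter.Eventually.of_forall fun y => ?_)
  simp only [norm_smul, norm_mul, Complex.norm_real, Real.norm_of_nonneg (Real.exp_pos _).le]
  ring

theorem integrable_kernel_smul (hn : 2 ≤ n) {α t : ℝ} (hα : 0 < α) (ht : 0 < t)
    (x : EuclideanSpace ℝ (Fin n)) (m : ℕ) :
    Integrable (fun y => kernel α x y • (Real.exp (-t * ‖y‖ ^ 2) • zForm hn y ^ m)) := by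
  refine Integrable.mono' (integrable_exp_mul_zForm_pow hn ht (16 * ‖x‖ / α) m)
    ((aestronglyMeasurable_kernel hn hα x).smul
      (Continuous.aestronglyMeasurable (by fun_prop))) (Filter.Eventually.of_forall fun y => ?_)
  rw [norm_smul, norm_smul, Real.norm_of_nonneg (Real.exp_pos _).le]
  gcongr
  exact abs_kernel_le hn hα x y

theorem moment_zero_zero (hn : 2 ≤ n) {t : ℝ} (ht : 0 < t) (x : EuclideanSpace ℝ (Fin n)) :
    moment hn t x 0 0 = ((Real.pi / t) ^ ((n : ℝ) / 2) : ℝ) := by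
  have h := GaussianFourier.integral_rexp_neg_mul_sq_norm (V := EuclideanSpace ℝ (Fin n)) ht
  rw [finrank_euclideanSpace_fin] at h
  rw [← h, moment, gint, ← integral_complex_ofReal]
  simp

/-- Weighted powers of `z` are eigenfunctions of the kernel up to the Gaussian weight. -/
theorem integral_kernel_smul (hn : 2 ≤ n) {α t : ℝ} (hα : 0 < α) (ht : 0 < t)
    (x : EuclideanSpace ℝ (Fin n)) (m : ℕ) :
    ∫ y, kernel α x y • (Real.exp (-t * ‖y‖ ^ 2) • zForm hn y ^ m)
      = (((Real.pi / t) ^ ((n : ℝ) / 2) * ((α * t) ^ m)⁻¹ : ℝ) : ℂ) * zForm hn x ^ m := by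
  -- The termwise bounds sum to exp(16|x||y|/α), integrable against the Gaussian weight, so sum and
  -- integral may be exchanged.
  have hsum := hasSum_integral_of_dominated_convergence (μ := volume)
    (F := fun k y => (zonalExt k x y / (α ^ k * (ascPochhammer ℝ k).eval ((n : ℝ) / 2)))
      • (Real.exp (-t * ‖y‖ ^ 2) • zForm hn y ^ m))
    (f := fun y => kernel α x y • (Real.exp (-t * ‖y‖ ^ 2) • zForm hn y ^ m))
    (fun k y => (16 * ‖x‖ / α * ‖y‖) ^ k / k.factorial
      * (Real.exp (-t * ‖y‖ ^ 2) * ‖zForm hn y ^ m‖))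
    (fun k => Continuous.aestronglyMeasurable (by
      have := continuous_zonalExt k x
      fun_prop))
    (fun k => Filter.Eventually.of_forall fun y => by
      rw [norm_smul, norm_smul, Real.norm_of_nonneg (Real.exp_pos _).le]
      gcongr
      exact abs_kernel_term_le hn hα k x y)
    (Filter.Eventually.of_forall fun y => (Real.summable_pow_div_factorial _).mul_right _)
    (by
      refine (integrable_exp_mul_zForm_pow hn ht (16 * ‖x‖ / α) m).congr
        (Filter.Eventually.of_forall fun y => ?_)
      simp only
      rw [tsum_mul_right, Real.exp_eq_exp_ℝ, NormedSpace.exp_eq_tsum_div])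
    (Filter.Eventually.of_forall fun y => (hasSum_kernel hn hα x y).smul_const _)
  have hterm : ∀ k, ∫ y, (zonalExt k x y / (α ^ k * (ascPochhammer ℝ k).eval ((n : ℝ) / 2)))
      • (Real.exp (-t * ‖y‖ ^ 2) • zForm hn y ^ m)
      = ((α ^ k * (ascPochhammer ℝ k).eval ((n : ℝ) / 2))⁻¹ : ℝ)
        * gint t (fun y => (zonalExt k x y : ℂ) * zForm hn y ^ m) := fun k => by
    rw [gint, ← integral_const_mul]
    refine integral_congr_ae (Filter.Eventually.of_forall fun y => ?_)
    simp only [Complex.real_smul]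
    push_cast
    ring
  simp only [hterm] at hsum
  rw [hsum.unique (hasSum_single m fun k hk => by rw [gint_zonalExt_of_ne hn ht x hk, mul_zero]),
    gint_zonalExt_self hn ht, moment_zero_zero hn ht]
  have hp := (ascPochhammer_half_pos hn m).ne'
  rw [← mul_assoc, ← Complex.ofReal_mul, ← Complex.ofReal_mul]
  congr 2
  rw [mul_pow]
  field_simp

/-- P_α commutes with the norm-preserving inclusion of ℝ in 𝕜, so real test functions suffice. -/
theorem BoundedOn.real {𝕜 : Type*} [RCLike 𝕜] {α β p : ℝ} (h : BoundedOn 𝕜 n α β p) :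
    BoundedOn ℝ n α β p := by
  obtain ⟨C, hC⟩ := h
  refine ⟨C, fun f hf hdom => ?_⟩
  have hproj : proj α (fun y => ((f y : ℝ) : 𝕜)) = fun x => ((proj α f x : ℝ) : 𝕜) := by
    funext x
    rw [proj, proj, ← integral_ofReal]
    simp [RCLike.real_smul_eq_coe_mul]
  have hnorm : ∀ g : EuclideanSpace ℝ (Fin n) → ℝ,
      eLpNorm (fun y => ((g y : ℝ) : 𝕜)) (ENNReal.ofReal p) (gaussian n β)
        = eLpNorm g (ENNReal.ofReal p) (gaussian n β) := fun g =>
    eLpNorm_congr_norm_ae (Filter.Eventually.of_forall fun y => by simp)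
  obtain ⟨h1, h2⟩ := hC (fun y => ((f y : ℝ) : 𝕜)) hf.ofReal (by
    filter_upwards [hdom] with x hx
    refine (hx.ofReal (𝕜 := 𝕜)).congr (Filter.Eventually.of_forall fun y => ?_)
    simp [RCLike.real_smul_eq_coe_mul])
  rw [hproj, hnorm, hnorm] at h2
  rw [hproj] at h1
  exact ⟨by simpa using h1.re, h2⟩

/-! ### Test functions and their projections. -/

/-- The normalising constant of the Gaussian measure. -/
def gaussConst (n : ℕ) (γ : ℝ) : ℝ := (Real.pi * γ) ^ (-(n : ℝ) / 2)

theorem gaussConst_pos {γ : ℝ} (hγ : 0 < γ) : 0 < gaussConst n γ := by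
  unfold gaussConst
  have := Real.pi_pos
  positivity

theorem toReal_density {γ : ℝ} (hγ : 0 < γ) (y : EuclideanSpace ℝ (Fin n)) :
    (ENNReal.ofReal ((Real.pi * γ) ^ (-(n : ℝ) / 2) * Real.exp (-‖y‖ ^ 2 / γ))).toReal
      = gaussConst n γ * Real.exp (-γ⁻¹ * ‖y‖ ^ 2) := by
  have := gaussConst_pos (n := n) hγ
  rw [← gaussConst, ENNReal.toReal_ofReal (by positivity)]
  congr 2
  field_simp

theorem measurable_density (γ : ℝ) : Measurable (fun y : EuclideanSpace ℝ (Fin n) =>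
    ENNReal.ofReal ((Real.pi * γ) ^ (-(n : ℝ) / 2) * Real.exp (-‖y‖ ^ 2 / γ))) := by
  fun_prop

theorem integral_gaussian {γ : ℝ} (hγ : 0 < γ) (f : EuclideanSpace ℝ (Fin n) → ℝ) :
    ∫ y, f y ∂(gaussian n γ) = gaussConst n γ * ∫ y, Real.exp (-γ⁻¹ * ‖y‖ ^ 2) * f y := by
  rw [gaussian, integral_withDensity_eq_integral_toReal_smul (measurable_density γ)
    (Filter.Eventually.of_forall fun _ => ENNReal.ofReal_lt_top), ← integral_const_mul]
  simp only [toReal_density hγ, smul_eq_mul, mul_assoc]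

theorem integrable_gaussian_iff {γ : ℝ} (hγ : 0 < γ) (f : EuclideanSpace ℝ (Fin n) → ℝ) :
    Integrable f (gaussian n γ) ↔ Integrable fun y => Real.exp (-γ⁻¹ * ‖y‖ ^ 2) * f y := by
  rw [gaussian, integrable_withDensity_iff_integrable_smul' (measurable_density γ)
    (Filter.Eventually.of_forall fun _ => ENNReal.ofReal_lt_top)]
  simp only [toReal_density hγ, smul_eq_mul, mul_assoc]
  exact integrable_const_mul_iff (gaussConst_pos hγ).ne'.isUnit _

/-- The harmonic polynomial `Re (y₀ + i y₁)^m`. -/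
def harm (hn : 2 ≤ n) (m : ℕ) (y : EuclideanSpace ℝ (Fin n)) : ℝ := (zForm hn y ^ m).re

theorem continuous_harm (hn : 2 ≤ n) (m : ℕ) : Continuous (harm hn m) := by
  unfold harm
  fun_prop

theorem harm_smul (hn : 2 ≤ n) (m : ℕ) (r : ℝ) (y : EuclideanSpace ℝ (Fin n)) :
    harm hn m (r • y) = r ^ m * harm hn m y := by
  simp only [harm, map_smul, Complex.real_smul, mul_pow]
  rw [← Complex.ofReal_pow, Complex.re_ofReal_mul]

theorem harm_single (hn : 2 ≤ n) (m : ℕ) :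
    harm hn m (EuclideanSpace.single ⟨0, by lia⟩ 1) = 1 := by
  simp [harm, zForm_apply]

/-- The test function `exp (-s|y|²) Re (y₀ + i y₁)^m`. -/
def testFun (hn : 2 ≤ n) (m : ℕ) (s : ℝ) (y : EuclideanSpace ℝ (Fin n)) : ℝ :=
  Real.exp (-s * ‖y‖ ^ 2) * harm hn m y

theorem density_mul_kernel_mul_testFun (hn : 2 ≤ n) {α s : ℝ} (m : ℕ)
    (x y : EuclideanSpace ℝ (Fin n)) :
    Real.exp (-α⁻¹ * ‖y‖ ^ 2) * (kernel α x y • testFun hn m s y)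
      = (kernel α x y • (Real.exp (-(s + α⁻¹) * ‖y‖ ^ 2) • zForm hn y ^ m)).re := by
  rw [Complex.smul_re, Complex.smul_re, ← harm, testFun,
    show -(s + α⁻¹) * ‖y‖ ^ 2 = -α⁻¹ * ‖y‖ ^ 2 + -s * ‖y‖ ^ 2 by ring, Real.exp_add]
  simp only [smul_eq_mul]
  ring

theorem add_inv_pos {α s : ℝ} (hα : 0 < α) (hs : 0 < 1 + s * α) : 0 < s + α⁻¹ := by
  have : s + α⁻¹ = (1 + s * α) / α := by
    field_simp
    ring
  rw [this]
  positivity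

theorem inDomain_testFun (hn : 2 ≤ n) {α s : ℝ} (hα : 0 < α) (hs : 0 < 1 + s * α) (m : ℕ) :
    InDomain α (testFun hn m s) := by
  refine Filter.Eventually.of_forall fun x => (integrable_gaussian_iff hα _).2 ?_
  simp only [density_mul_kernel_mul_testFun]
  exact (integrable_kernel_smul hn hα (add_inv_pos hα hs) x m).re

/-- The density of μ_α merges with the Gaussian factor into exp(-t|y|²), t = s + 1/α, so that αt = 1
+ sα. -/
theorem proj_testFun (hn : 2 ≤ n) {α s : ℝ} (hα : 0 < α) (hs : 0 < 1 + s * α) (m : ℕ)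
    (x : EuclideanSpace ℝ (Fin n)) :
    proj α (testFun hn m s) x = (1 + s * α) ^ (-(m + (n : ℝ) / 2)) * harm hn m x := by
  have ht := add_inv_pos hα hs
  have hre := integral_re (𝕜 := ℂ) (integrable_kernel_smul hn hα ht x m)
  rw [integral_kernel_smul hn hα ht] at hre
  rw [proj, integral_gaussian hα]
  simp only [density_mul_kernel_mul_testFun]
  simp only [RCLike.re_eq_complex_re, Complex.re_ofReal_mul] at hre
  rw [hre, ← harm, ← mul_assoc]
  congr 1
  have h1 : α * (s + α⁻¹) = 1 + s * α := by
    field_simp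
    ring
  have h2 : Real.pi / (s + α⁻¹) = Real.pi * α / (1 + s * α) := by
    rw [← h1]
    field_simp
  have hpa : 0 < Real.pi * α := mul_pos Real.pi_pos hα
  rw [h1, h2, gaussConst, Real.div_rpow hpa.le hs.le, neg_add, Real.rpow_add hs, neg_div,
    Real.rpow_neg hpa.le, Real.rpow_neg hs.le, Real.rpow_neg hs.le, Real.rpow_natCast]
  have := (Real.rpow_pos_of_pos hpa ((n : ℝ) / 2)).ne'
  have := (Real.rpow_pos_of_pos hs ((n : ℝ) / 2)).ne'
  field_simp

/-! ### Norms of the test functions. -/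

theorem expGrowth_harm_rpow (hn : 2 ≤ n) (m : ℕ) {p : ℝ} (hp : 0 < p) :
    ExpGrowth (fun y => |harm hn m y| ^ p) := by
  obtain ⟨C, B, hC, hB, h⟩ := ((tame_clm (zForm hn)).pow m).2.exists_nonneg
  refine ⟨(continuous_harm hn m).abs.rpow_const fun _ => Or.inr hp.le, C ^ p, B * p, fun y => ?_⟩
  rw [Real.norm_of_nonneg (by positivity)]
  calc |harm hn m y| ^ p ≤ (C * Real.exp (B * ‖y‖)) ^ p := by
        gcongr
        exact (Complex.abs_re_le_norm _).trans (h y)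
    _ = C ^ p * Real.exp (B * p * ‖y‖) := by
        rw [Real.mul_rpow hC (Real.exp_pos _).le, ← Real.exp_mul]
        ring_nf

/-- Substitute y ↦ √c y and use homogeneity of degree m. -/
theorem integral_harm_rpow (hn : 2 ≤ n) (m : ℕ) {p c : ℝ} (hc : 0 < c) :
    ∫ y, Real.exp (-c * ‖y‖ ^ 2) * |harm hn m y| ^ p
      = c ^ (-((m * p + n) / 2)) * ∫ y, Real.exp (-1 * ‖y‖ ^ 2) * |harm hn m y| ^ p := by
  have h := Measure.integral_comp_smul (volume : Measure (EuclideanSpace ℝ (Fin n)))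
    (fun y => Real.exp (-1 * ‖y‖ ^ 2) * |harm hn m y| ^ p) (c ^ (1 / 2 : ℝ))
  have hr : 0 < c ^ (1 / 2 : ℝ) := Real.rpow_pos_of_pos hc _
  have hr2 : (c ^ (1 / 2 : ℝ)) ^ 2 = c := by
    rw [← Real.rpow_natCast, ← Real.rpow_mul hc.le]
    norm_num
  have hpt : ∀ y : EuclideanSpace ℝ (Fin n),
      Real.exp (-1 * ‖c ^ (1 / 2 : ℝ) • y‖ ^ 2) * |harm hn m (c ^ (1 / 2 : ℝ) • y)| ^ p
      = c ^ (m * p / 2) * (Real.exp (-c * ‖y‖ ^ 2) * |harm hn m y| ^ p) := fun y => by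
    rw [norm_smul, mul_pow, Real.norm_of_nonneg hr.le, hr2, harm_smul, abs_mul,
      abs_of_pos (pow_pos hr m), Real.mul_rpow (pow_pos hr m).le (abs_nonneg _),
      ← Real.rpow_natCast (c ^ (1 / 2 : ℝ)) m, ← Real.rpow_mul hc.le, ← Real.rpow_mul hc.le,
      show -1 * (c * ‖y‖ ^ 2) = -c * ‖y‖ ^ 2 by ring,
      show (1 / 2 : ℝ) * m * p = m * p / 2 by ring]
    ring
  simp only [hpt] at h
  rw [integral_const_mul, finrank_euclideanSpace_fin, smul_eq_mul,
    abs_of_pos (inv_pos.2 (pow_pos hr n)), ← Real.rpow_natCast, ← Real.rpow_mul hc.le] at h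
  have hcp : 0 < c ^ (m * p / 2) := Real.rpow_pos_of_pos hc _
  rw [← mul_right_inj' hcp.ne', h, ← mul_assoc, ← Real.rpow_neg hc.le, ← Real.rpow_add hc]
  congr 2
  ring

theorem integral_harm_rpow_pos (hn : 2 ≤ n) (m : ℕ) {p : ℝ} (hp : 0 < p) :
    0 < ∫ y, Real.exp (-1 * ‖y‖ ^ 2) * |harm hn m y| ^ p := by
  have hg := expGrowth_harm_rpow hn m hp
  have hcont : Continuous fun y => Real.exp (-1 * ‖y‖ ^ 2) * |harm hn m y| ^ p := by
    have := hg.1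
    fun_prop
  rw [integral_pos_iff_support_of_nonneg (fun y => by positivity)
    (by simpa only [smul_eq_mul] using hg.integrable one_pos)]
  refine hcont.isOpen_support.measure_pos _ ⟨EuclideanSpace.single ⟨0, by lia⟩ 1, ?_⟩
  simp only [Function.mem_support, harm_single, abs_one, Real.one_rpow, mul_one]
  exact (Real.exp_pos _).ne'

theorem norm_testFun_rpow (hn : 2 ≤ n) (m : ℕ) {β p : ℝ} (s : ℝ) (y : EuclideanSpace ℝ (Fin n)) :
    Real.exp (-β⁻¹ * ‖y‖ ^ 2) * ‖testFun hn m s y‖ ^ p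
      = Real.exp (-(p * s + β⁻¹) * ‖y‖ ^ 2) * |harm hn m y| ^ p := by
  rw [testFun, norm_mul, Real.norm_of_nonneg (Real.exp_pos _).le,
    Real.mul_rpow (Real.exp_pos _).le (norm_nonneg _), ← Real.exp_mul, ← mul_assoc, ← Real.exp_add,
    Real.norm_eq_abs]
  congr 2
  ring

theorem memLp_testFun (hn : 2 ≤ n) (m : ℕ) {β p s : ℝ} (hβ : 0 < β) (hp : 0 < p)
    (hs : 0 < 1 + p * s * β) :
    MemLp (testFun hn m s) (ENNReal.ofReal p) (gaussian n β) := by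
  have hc : Continuous (testFun hn m s) := by
    have := continuous_harm hn m
    unfold testFun
    fun_prop
  rw [← integrable_norm_rpow_iff hc.aestronglyMeasurable (by simpa using hp)
    ENNReal.ofReal_ne_top, ENNReal.toReal_ofReal hp.le, integrable_gaussian_iff hβ]
  simp only [norm_testFun_rpow]
  simpa only [smul_eq_mul] using (expGrowth_harm_rpow hn m hp).integrable (add_inv_pos hβ hs)

/-- Since ps + 1/β = (1 + psβ)/β, scaling isolates all dependence on s in the first factor. -/
theorem eLpNorm_testFun (hn : 2 ≤ n) (m : ℕ) {β p s : ℝ} (hβ : 0 < β) (hp : 0 < p)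
    (hs : 0 < 1 + p * s * β) :
    eLpNorm (testFun hn m s) (ENNReal.ofReal p) (gaussian n β)
      = ENNReal.ofReal ((1 + p * s * β) ^ (-(m / 2 + n / (2 * p)))
        * (gaussConst n β * (β⁻¹ ^ (-((m * p + n) / 2))
          * ∫ y, Real.exp (-1 * ‖y‖ ^ 2) * |harm hn m y| ^ p)) ^ p⁻¹) := by
  rw [(memLp_testFun hn m hβ hp hs).eLpNorm_eq_integral_rpow_norm (by simpa using hp)
    ENNReal.ofReal_ne_top, ENNReal.toReal_ofReal hp.le, integral_gaussian hβ]
  simp only [norm_testFun_rpow]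
  rw [integral_harm_rpow hn m (add_inv_pos hβ hs)]
  have hK := integral_harm_rpow_pos hn m hp
  have hG := gaussConst_pos (n := n) hβ
  generalize (∫ y, Real.exp (-1 * ‖y‖ ^ 2) * |harm hn m y| ^ p) = K at hK ⊢
  have e : p * s + β⁻¹ = (1 + p * s * β) * β⁻¹ := by
    field_simp
    ring
  rw [e, Real.mul_rpow hs.le (by positivity)]
  congr 1
  have h1 : 0 < β⁻¹ ^ (-((m * p + n) / 2)) := by positivity
  rw [show gaussConst n β * ((1 + p * s * β) ^ (-((m * p + n) / 2)) * β⁻¹ ^ (-((m * p + n) / 2)) * K)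
    = (1 + p * s * β) ^ (-((m * p + n) / 2)) * (gaussConst n β * (β⁻¹ ^ (-((m * p + n) / 2)) * K))
    by ring, Real.mul_rpow (by positivity) (by positivity), ← Real.rpow_mul hs.le]
  congr 2
  field_simp

/-! ### Consequences of boundedness. -/

/-- Boundedness on `L^p` forces an inequality between the eigenvalues and the norms of the test
functions. -/
theorem BoundedOn.exists_le (hn : 2 ≤ n) {α β p : ℝ} (hα : 0 < α) (hβ : 0 < β) (hp : 0 < p)
    (h : BoundedOn ℝ n α β p) :
    ∃ C : ℝ, ∀ (m : ℕ) (s : ℝ), 0 < 1 + s * α → 0 < 1 + p * s * β →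
      (1 + s * α) ^ (-(m + (n : ℝ) / 2)) ≤ C * (1 + p * s * β) ^ (-((m : ℝ) / 2 + n / (2 * p))) := by
  obtain ⟨C, hC⟩ := h
  refine ⟨C, fun m s hs hs' => ?_⟩
  have h2 := (hC _ (memLp_testFun hn m hβ hp hs') (inDomain_testFun hn hα hs m)).2
  -- The projection is a multiple of the test function with s = 0, so the common norm `N` cancels.
  have hproj : proj α (testFun hn m s)
      = (1 + s * α) ^ (-(m + (n : ℝ) / 2)) • testFun hn m 0 := by
    funext x
    rw [proj_testFun hn hα hs]
    simp [testFun]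
  rw [hproj, eLpNorm_const_smul, eLpNorm_testFun hn m hβ hp hs',
    eLpNorm_testFun hn m hβ hp (by simp)] at h2
  have hK := integral_harm_rpow_pos hn m hp
  have hG := gaussConst_pos (n := n) hβ
  have hN : 0 < (gaussConst n β * (β⁻¹ ^ (-((m * p + n) / 2))
      * ∫ y, Real.exp (-1 * ‖y‖ ^ 2) * |harm hn m y| ^ p)) ^ p⁻¹ := by positivity
  generalize (gaussConst n β * (β⁻¹ ^ (-((m * p + n) / 2))
      * ∫ y, Real.exp (-1 * ‖y‖ ^ 2) * |harm hn m y| ^ p)) ^ p⁻¹ = N at hN h2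
  have hl : 0 < (1 + s * α) ^ (-(m + (n : ℝ) / 2)) := by positivity
  rw [← ofReal_norm, Real.norm_of_nonneg hl.le, ← ENNReal.ofReal_coe_nnreal,
    ← ENNReal.ofReal_mul hl.le, ← ENNReal.ofReal_mul C.coe_nonneg,
    ENNReal.ofReal_le_ofReal_iff (by positivity)] at h2
  simp only [mul_zero, zero_mul, add_zero, Real.one_rpow, one_mul] at h2
  exact le_of_mul_le_mul_right (by linarith) hN

/-- Otherwise √D / A > 1, and its powers would exceed the bound that the hypothesis puts on them for
all m. -/
theorem le_sq_of_bounded {A D a b C : ℝ} (hA : 0 < A) (hD : 0 < D)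
    (h : ∀ m : ℕ, A ^ (-((m : ℝ) + a)) ≤ C * D ^ (-((m : ℝ) / 2 + b))) : D ≤ A ^ 2 := by
  by_contra! hlt
  have hr : 1 < D ^ (1 / 2 : ℝ) / A := by
    rw [one_lt_div hA, ← Real.sqrt_eq_rpow]
    exact Real.lt_sqrt_of_sq_lt hlt
  obtain ⟨m, hm⟩ := ((tendsto_pow_atTop_atTop_of_one_lt hr).eventually_gt_atTop
    (C * D ^ (-b) * A ^ a)).exists
  have hm' := h m
  rw [neg_add, neg_add, Real.rpow_add hA, Real.rpow_add hD, Real.rpow_neg hA.le (m : ℝ),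
    Real.rpow_neg hD.le ((m : ℝ) / 2), Real.rpow_natCast, Real.rpow_neg hA.le a,
    show (m : ℝ) / 2 = 1 / 2 * m by ring, Real.rpow_mul hD.le, Real.rpow_natCast] at hm'
  rw [div_pow, lt_div_iff₀ (pow_pos hA m)] at hm
  have hAa := Real.rpow_pos_of_pos hA a
  have hDm := pow_pos (Real.rpow_pos_of_pos hD (1 / 2)) m
  have hAm := pow_pos hA m
  rw [← mul_inv, inv_le_iff_one_le_mul₀ (by positivity)] at hm'
  have : C * ((D ^ (1 / 2 : ℝ)) ^ m)⁻¹ * D ^ (-b) * (A ^ m * A ^ a)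
      = (C * D ^ (-b) * A ^ a * A ^ m) / (D ^ (1 / 2 : ℝ)) ^ m := by
    field_simp
  have h3 : (C * D ^ (-b) * A ^ a * A ^ m) / (D ^ (1 / 2 : ℝ)) ^ m < 1 := (div_lt_one hDm).2 hm
  rw [← this] at h3
  linarith

theorem BoundedOn.mul_eq (hn : 2 ≤ n) {α β p : ℝ} (hα : 0 < α) (hβ : 0 < β) (hp : 0 < p)
    (h : BoundedOn ℝ n α β p) : p * β = 2 * α := by
  obtain ⟨C, hC⟩ := h.exists_le hn hα hβ hp
  have key : ∀ s, 0 < 1 + s * α → 0 < 1 + p * s * β → 1 + p * s * β ≤ (1 + s * α) ^ 2 :=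
    fun s h1 h2 => le_sq_of_bounded h1 h2 fun m => hC m s h1 h2
  have hpβ : 0 < p * β := mul_pos hp hβ
  -- The cases s = ε and s = -ε bound the difference of slopes from both sides.
  have hbound : ∀ ε, 0 < ε → ε * α < 1 → ε * (p * β) < 1 → |p * β - 2 * α| ≤ ε * α ^ 2 := by
    intro ε hε h1 h2
    have k1 := key ε (by positivity) (by positivity)
    have k2 := key (-ε) (by linarith) (by nlinarith)
    rw [abs_le]
    constructor <;> refine le_of_mul_le_mul_left ?_ hε <;> nlinarith
  by_contra hne
  have hδ : 0 < |p * β - 2 * α| := abs_pos.2 (sub_ne_zero.2 hne)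
  set δ := |p * β - 2 * α|
  have hS : 0 < α + p * β + α ^ 2 / δ + 1 := by positivity
  -- This ε is below 1/α and 1/(pβ), and makes εα² < δ.
  have hb := hbound (1 / (2 * (α + p * β + α ^ 2 / δ + 1))) (by positivity)
    (by
      have : 0 < α ^ 2 / δ := by positivity
      rw [div_mul_eq_mul_div, div_lt_one (by positivity)]
      linarith)
    (by
      have : 0 < α ^ 2 / δ := by positivity
      rw [div_mul_eq_mul_div, div_lt_one (by positivity)]
      linarith)
  rw [div_mul_eq_mul_div, le_div_iff₀ (by positivity)] at hb
  have h3 : δ * (α ^ 2 / δ) = α ^ 2 := by field_simp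
  nlinarith [mul_pos hδ hα, mul_pos hδ hpβ, sq_nonneg α]

/-- Gaussians (m = 0) suffice: for p < 1 their norms decay faster in s than those of their
projections. -/
theorem not_boundedOn_of_lt_one (hn : 2 ≤ n) {α β p : ℝ} (hα : 0 < α) (hβ : 0 < β) (hp : 0 < p)
    (hp1 : p < 1) : ¬ BoundedOn ℝ n α β p := by
  intro h
  obtain ⟨C, hC⟩ := h.exists_le hn hα hβ hp
  have hn0 : (0 : ℝ) < n := by exact_mod_cast (by lia : 0 < n)
  set e : ℝ := n / (2 * p) - n / 2 with he
  have hepos : 0 < e := by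
    have : (n : ℝ) / (2 * p) - n / 2 = n * (1 - p) / (2 * p) := by field_simp
    rw [he, this]
    have : 0 < 1 - p := by linarith
    positivity
  -- for large `s` the two sides scale as `s ^ (-n/2)` and `s ^ (-n/(2p))`
  have hle : ∀ s : ℝ, 1 ≤ s → s ^ e ≤ C * (p * β) ^ (-((n : ℝ) / (2 * p)))
      * (1 + α) ^ ((n : ℝ) / 2) := by
    intro s hs
    have hs0 : 0 < s := by linarith
    have h1 := hC 0 s (by positivity) (by positivity)
    simp only [Nat.cast_zero, zero_add, zero_div] at h1
    have hC0 : 0 ≤ C := by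
      by_contra! hneg
      have : 0 < (1 + s * α) ^ (-((n : ℝ) / 2)) := by positivity
      have h3 : C * (1 + p * s * β) ^ (-((n : ℝ) / (2 * p))) < 0 :=
        mul_neg_of_neg_of_pos hneg (by positivity)
      linarith
    -- Since s ≥ 1, 1 + sα ≤ (1 + α)s; the negative exponent reverses the inequality.
    have hA : ((1 + α) * s) ^ (-((n : ℝ) / 2)) ≤ (1 + s * α) ^ (-((n : ℝ) / 2)) :=
      Real.rpow_le_rpow_of_nonpos (by positivity) (by nlinarith) (by linarith [half_pos hn0])
    have hD : (1 + p * s * β) ^ (-((n : ℝ) / (2 * p))) ≤ (p * β * s) ^ (-((n : ℝ) / (2 * p))) :=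
      Real.rpow_le_rpow_of_nonpos (by positivity) (by nlinarith)
        (by linarith [div_pos hn0 (show 0 < 2 * p by linarith)])
    have h2 := (hA.trans h1).trans (mul_le_mul_of_nonneg_left hD hC0)
    rw [Real.mul_rpow (by positivity) hs0.le, Real.mul_rpow (by positivity) hs0.le] at h2
    have hse : s ^ e = s ^ (-((n : ℝ) / 2)) * s ^ ((n : ℝ) / (2 * p)) := by
      rw [← Real.rpow_add hs0, he]
      congr 1
      ring
    have hi1 : s ^ (-((n : ℝ) / (2 * p))) * s ^ ((n : ℝ) / (2 * p)) = 1 := by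
      rw [← Real.rpow_add hs0, neg_add_cancel, Real.rpow_zero]
    have hi2 : (1 + α) ^ (-((n : ℝ) / 2)) * (1 + α) ^ ((n : ℝ) / 2) = 1 := by
      rw [← Real.rpow_add (by positivity), neg_add_cancel, Real.rpow_zero]
    have hm := mul_le_mul_of_nonneg_right h2
      (show 0 ≤ s ^ ((n : ℝ) / (2 * p)) * (1 + α) ^ ((n : ℝ) / 2) by positivity)
    calc s ^ e = (1 + α) ^ (-((n : ℝ) / 2)) * s ^ (-((n : ℝ) / 2))
          * (s ^ ((n : ℝ) / (2 * p)) * (1 + α) ^ ((n : ℝ) / 2)) := by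
          rw [hse]
          linear_combination -(s ^ (-((n : ℝ) / 2)) * s ^ ((n : ℝ) / (2 * p))) * hi2
      _ ≤ _ := hm
      _ = _ := by
          linear_combination C * (p * β) ^ (-((n : ℝ) / (2 * p))) * (1 + α) ^ ((n : ℝ) / 2) * hi1
  obtain ⟨s, hs1, hs2⟩ := (((tendsto_rpow_atTop hepos).eventually_gt_atTop
    (C * (p * β) ^ (-((n : ℝ) / (2 * p))) * (1 + α) ^ ((n : ℝ) / 2))).and
      (Filter.eventually_ge_atTop 1)).exists
  linarith [hle s hs2]

end HarmonicFock

end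

theorem lemma2p2 (𝕜 : Type*) [RCLike 𝕜] (n : ℕ) (hn : 2 ≤ n) (α β p : ℝ)
    (hα : 0 < α) (hβ : 0 < β) :
    (1 ≤ p → HarmonicFock.BoundedOn 𝕜 n α β p → p * β = 2 * α) ∧
      (0 < p → p < 1 → ¬ HarmonicFock.BoundedOn 𝕜 n α β p) := by
  exact ⟨fun hp h => h.real.mul_eq hn hα hβ (by linarith),
    fun hp hp1 h => HarmonicFock.not_boundedOn_of_lt_one hn hα hβ hp hp1 h.real⟩
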